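/- \textbf{Setting.} Let $N$ be a finite set of agents and let $M_j$ be a set of explicit strategies for each $j\in N$. For $D\subseteq N$ put $M_D=\prod_{j\in D}M_j$; for $n\in M_D$, $m\in M_E$ write $n=_\sqcap m$ if $n_i=m_i$ for all $i\in D\cap E$. The modalities are $[C,O]$ and $\langle C,O\rangle$, where $C\subseteq N$ and $O$ is a finite set of joint explicit moves $O\subseteq M_D$ for a coalition $D=\mathsf{Ag}(O)$ disjoint from $C$, and where $|O|=1$ if $C\cup D=N$. A one-step game with explicit strategies over a set $X$ consists of numbers $k_j\ge 1$, giving agent $j$ the finite set $[k_j]$ of moves, an outcome function $f:\prod_{j\in N}[k_j]\to X$, and maps $\iota_j:M_j\to[k_j]$. For $Y\subseteq X$, it belongs to $[\![\,[C,O]\,]\!](Y)$ if there is a joint move $m_C$ of $C$ such that $f(m)\in Y$ for all joint moves $m$ of $N$ that extend $m_C$ and extend $\iota(n)$ for some $n\in O$; it belongs to $[\![\langle C,O\rangle]\!](Y)$ if for every joint move $m_C$ of $C$ there is such an $m$ (extending $m_C$ and some $\iota(n)$, $n\in O$) with $f(m)\in Y$. A modal atom is a modality applied to a variable $a\in \mathsf{PV}$.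 Given a valuation $\tau:\mathsf{PV}\to\mathcal P(X)$, a game satisfies a set $\Xi$ of modal atoms if it lies in $[\![\heartsuit]\!](\tau(a))$ for all $\heartsuit a\in\Xi$, and the extension of a set $\Theta$ of variables is $[\![\Theta]\!]\tau=\bigcap_{a\in\Theta}\tau(a)\subseteq X$. \textbf{Rules.} An instance of (Rc) has as its premiss a finite set of pairwise distinct modal atoms $$[D_1,P_{G_1}]a_1,\dots,[D_\alpha,P_{G_\alpha}]a_\alpha,\ \langle E,Q_K\rangle b,\ \langle C_1,\{r_{H_1}\}\rangle c_1,\dots,\langle C_\beta,\{r_{H_\beta}\}\rangle c_\beta\qquad(\alpha,\beta\ge 0)$$ (subscripts $G_j,K,H_j$ denote the coalitions $\mathsf{Ag}(\cdot)$), and, for each $q\in Q_K$, one conclusion $\{a_j\mid j\in A_q\}\cup\{b\}\cup\{c_j\mid j\in B_q\}$, where $A_q\subseteq\{1,\dots,\alpha\}$ and $B_q\subseteq\{1,\dots,\beta\}$, such that, with $L=\bigcup_jG_j\cup\bigcup_jH_j$: (1) $D_j\cap D_k=\emptyset$ for $j\ne k$; (2) $C_j\cup H_j=N$ for all $j$;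 (3) $\bigcup_jD_j\cap L=\emptyset$; (4) $\bigcup_jD_j\subseteq E$; (5) $L\subseteq E\cup K$; (6) $r_{H_j}=_\sqcap q$ for all $q\in Q_K$, $j\in B_q$; (7) there is $l\in M_{E\cap L}$ such that for all $q\in Q_K$: $r_{H_j}=_\sqcap l$ for each $j\in B_q$, and for each $j\in A_q$ there is $p\in P_{G_j}$ with $p=_\sqcap q$ and $p=_\sqcap l$. An instance of (Rs) has as its premiss a finite set of pairwise distinct modal atoms as above but without $\langle E,Q_K\rangle b$, and the single conclusion $\{a_1,\dots,a_\alpha,c_1,\dots,c_\beta\}$, subject to (1)--(3) and: there is $l\in M_L$ such that $r_{H_j}=_\sqcap l$ for all $j\le\beta$, and for each $j\le\alpha$ there is $p\in P_{G_j}$ with $p=_\sqcap l$. \textbf{Lemma (one-step tableau completeness).} Let $X$ be a set, $\tau:\mathsf{PV}\to\mathcal P(X)$ a valuation and $\Xi$ a finite set of modal atoms. If every instance of (Rs) or (Rc) whose premiss is contained in $\Xi$ has a conclusion $\Theta$ with $[\![\Theta]\!]\tau\ne\emptyset$, then some one-step game with explicit strategies over $X$ (hence with finitely many moves for each agent) satisfies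 $\Xi$ under $\tau$. -/

import Mathlib

namespace AMCDES

universe uΛ uV uN uM uX uF

/-! ### One-step tableau rules in coalgebraic logic -/

/-- An instance `Φ / Θ₁ ∣ … ∣ Θₙ` of a (monotone) one-step tableau rule over the modalities `Λ`,
its variables being instantiated by elements of `PV`; a pair `(♥, a)` is the modal atom `♥ a`.
The premiss and the conclusions are read conjunctively. -/
structure RuleInstance (Λ : Type uΛ) (PV : Type uV) where
  premiss : Set (Λ × PV)
  conclusions : Set (Set PV)
  premiss_finite : premiss.Finite
  conclusions_finite : conclusions.Finite
  conclusions_subset : ∀ Θ ∈ conclusions, Θ ⊆ Prod.snd '' premiss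

/-- The extension `⟦Θ⟧τ` of a finite set of variables, read conjunctively. -/
def varsExt {PV : Type uV} {X : Type uX} (τ : PV → Set X) (Θ : Set PV) : Set X :=
  {x | ∀ a ∈ Θ, x ∈ τ a}

/-- The extension `⟦Ξ⟧τ ⊆ F X` of a set of modal atoms, read conjunctively, where `lift ♥ X` is
the predicate lifting that interprets `♥`. -/
def atomsExt {Λ : Type uΛ} {PV : Type uV} {F : Type uX → Type uF}
    (lift : Λ → (X : Type uX) → Set X → Set (F X))
    {X : Type uX} (τ : PV → Set X) (Ξ : Set (Λ × PV)) : Set (F X) :=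
  {t | ∀ φ ∈ Ξ, t ∈ lift φ.1 X (τ φ.2)}

/-- One-step tableau completeness of a set of rules, given by all its instances: a finite set `Ξ`
of modal atoms is satisfied by some one-step structure as soon as every rule instance with premiss
contained in `Ξ` has some conclusion with nonempty extension. -/
def OneStepTableauComplete {Λ : Type uΛ} {PV : Type uV} {F : Type uX → Type uF}
    (lift : Λ → (X : Type uX) → Set X → Set (F X)) (Rules : Set (RuleInstance Λ PV)) : Prop :=
  ∀ (X : Type uX) (τ : PV → Set X) (Ξ : Set (Λ × PV)), Ξ.Finite →
    (∀ ρ ∈ Rules, ρ.premiss ⊆ Ξ → ∃ Θ ∈ ρ.conclusions, (varsExt τ Θ).Nonempty) →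
    (atomsExt lift τ Ξ).Nonempty

/-! ### Modalities and one-step games with explicit strategies

`N` is the set of agents, and `M j` is the set of explicit strategies (names) of agent `j`. -/

variable {N : Type uN}

/-- The set `M_D` of joint explicit moves of the coalition `D`. -/
abbrev JointMove (M : N → Type uM) (D : Set N) : Type (max uN uM) := (i : D) → M i

/-- `n` and `m` assign the same explicit move to every agent on which both are defined. -/
def Compatible {M : N → Type uM} {D E : Set N} (n : JointMove M D) (m : JointMove M E) : Prop :=
  ∀ (i : N) (hD : i ∈ D) (hE : i ∈ E), n ⟨i, hD⟩ = m ⟨i, hE⟩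

/-- The index `C, O` of the modalities `[C, O]` and `⟨C, O⟩`: a coalition `C` and a disjunctive
explicit strategy `O`, that is, a finite set of joint explicit moves of a coalition `Ag(O) = ag`
disjoint from `C`. Grand coalition modalities are non-disjunctive. -/
structure ModIndex (M : N → Type uM) where
  C : Set N
  ag : Set N
  O : Set (JointMove M ag)
  finite_O : O.Finite
  disjoint : Disjoint C ag
  grand : C ∪ ag = Set.univ → ∃ n, O = {n}

/-- The modal operators `[C, O]` and `⟨C, O⟩`. -/
inductive Modality (M : N → Type uM) where
  | box (s : ModIndex M) : Modality M
  | dia (s : ModIndex M) : Modality M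

/-- One-step games with explicit strategies over `X`: each agent `j` has the finite nonempty set
`Fin (k j)` of moves, `outcome` is the outcome function, and `interp` interprets the explicit
strategies as moves. -/
structure Game (M : N → Type uM) (X : Type uX) where
  k : N → ℕ
  one_le_k : ∀ j, 1 ≤ k j
  outcome : ((j : N) → Fin (k j)) → X
  interp : (j : N) → M j → Fin (k j)

/-- The joint move `m` of all agents restricts on `Ag(O)` to the interpretation of some element
of `O`. -/
def Game.Follows {M : N → Type uM} {X : Type uX} (g : Game M X) (s : ModIndex M)
    (m : (j : N) → Fin (g.k j)) : Prop :=
  ∃ n ∈ s.O, ∀ i : s.ag, m i = g.interp i (n i)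

/-- The predicate liftings interpreting `[C, O]` and its dual `⟨C, O⟩`. -/
def lifting {M : N → Type uM} : Modality M → (X : Type uX) → Set X → Set (Game M X)
  | .box s, _, Y => {g | ∃ mC : (i : s.C) → Fin (g.k i), ∀ m : (j : N) → Fin (g.k j),
      (∀ i : s.C, m i = mC i) → g.Follows s m → g.outcome m ∈ Y}
  | .dia s, _, Y => {g | ∀ mC : (i : s.C) → Fin (g.k i), ∃ m : (j : N) → Fin (g.k j),
      (∀ i : s.C, m i = mC i) ∧ g.Follows s m ∧ g.outcome m ∈ Y}

/-! ### The rules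

In both rules, `A` is the set of the boxes `[D_j, P_{G_j}] a_j` and `B` is the set of the diamonds
`⟨C_j, r_{H_j}⟩ c_j` in the premiss, listed without their modality symbol. -/

variable {M : N → Type uM} {PV : Type uV}

/-- The set of modal atoms consisting of the boxes in `A` and the diamonds in `B`. -/
def atomsOf (A B : Set (ModIndex M × PV)) : Set (Modality M × PV) :=
  (fun x => (Modality.box x.1, x.2)) '' A ∪ (fun x => (Modality.dia x.1, x.2)) '' B

/-- `L`, the set of all agents for whom the boxes in `A` or the diamonds in `B` name moves. -/
def namedAgents (A B : Set (ModIndex M × PV)) : Set N :=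
  (⋃ x ∈ A, x.1.ag) ∪ (⋃ x ∈ B, x.1.ag)

/-- The side conditions that do not involve the distinguished diamond: the coalitions of the boxes
are pairwise disjoint, `C ∪ H` is the grand coalition for every diamond in `B` (which is then
non-disjunctive), and the coalitions of the boxes are disjoint from `L`. -/
def BasicConditions (A B : Set (ModIndex M × PV)) : Prop :=
  (∀ x ∈ A, ∀ y ∈ A, x ≠ y → Disjoint x.1.C y.1.C) ∧
  (∀ x ∈ B, x.1.C ∪ x.1.ag = Set.univ) ∧
  Disjoint (⋃ x ∈ A, x.1.C) (namedAgents A B)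

/-- The instances of the rule `(Rc)`, with distinguished diamond `⟨E, Q_K⟩ b`, where
`E = s.C`, `K = s.ag`, `Q_K = s.O`, and with one conclusion for each `q ∈ Q_K`, given by index sets
`Aq q ⊆ A` and `Bq q ⊆ B`. -/
def ruleRc (M : N → Type uM) (PV : Type uV) : Set (RuleInstance (Modality M) PV) :=
  {ρ | ∃ (A B : Set (ModIndex M × PV)) (s : ModIndex M) (b : PV)
      (Aq Bq : JointMove M s.ag → Set (ModIndex M × PV)),
    (s, b) ∉ B ∧
    (∀ q ∈ s.O, Aq q ⊆ A ∧ Bq q ⊆ B) ∧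
    BasicConditions A B ∧
    (⋃ x ∈ A, x.1.C) ⊆ s.C ∧
    namedAgents A B ⊆ s.C ∪ s.ag ∧
    (∀ q ∈ s.O, ∀ x ∈ Bq q, ∀ r ∈ x.1.O, Compatible r q) ∧
    (∃ l : JointMove M (s.C ∩ namedAgents A B), ∀ q ∈ s.O,
      (∀ x ∈ Bq q, ∀ r ∈ x.1.O, Compatible r l) ∧
      (∀ x ∈ Aq q, ∃ p ∈ x.1.O, Compatible p q ∧ Compatible p l)) ∧
    ρ.premiss = atomsOf A (insert (s, b) B) ∧
    ρ.conclusions = {Θ | ∃ q ∈ s.O, Θ = Prod.snd '' Aq q ∪ {b} ∪ Prod.snd '' Bq q}}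

/-- The instances of the rule `(Rs)`, which has a single conclusion. -/
def ruleRs (M : N → Type uM) (PV : Type uV) : Set (RuleInstance (Modality M) PV) :=
  {ρ | ∃ A B : Set (ModIndex M × PV),
    BasicConditions A B ∧
    (∃ l : JointMove M (namedAgents A B),
      (∀ x ∈ B, ∀ r ∈ x.1.O, Compatible r l) ∧
      (∀ x ∈ A, ∃ p ∈ x.1.O, Compatible p l)) ∧
    ρ.premiss = atomsOf A B ∧
    ρ.conclusions = {Prod.snd '' A ∪ Prod.snd '' B}}

end AMCDES

namespace AMCDES

/-! A move of an agent is either a name, or a vote for an atom together with a vector in `Ξ → ZMod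
2`. A joint move activates the boxes whose whole coalition votes for them and whose explicit
strategy is played, and the grand coalition diamonds whose explicit strategy is played; the sum of
all vectors may select one diamond. Naming and voting exclude each other, so the active atoms form a
premiss of (Rs) and their variables share a point (`activeVars_ext_nonempty`). The outcome is such a
point, chosen to realize the selected diamond too whenever possible. For a non-grand diamond, let
the agents outside it neither vote nor name. Then (Rc), applied to all atoms active under some `q`
in its explicit strategy, yields a `q` for which this is possible
(`activeVars_insert_ext_nonempty`). Selection can be forced before `q` is known, as names contribute
zero to the sum (`exists_number_eq`). -/

variable {N : Type*} {M : N → Type*} {PV : Type*}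

/-! ### Moves: names, votes and numbers. -/

/-- The index of a modality. -/
def Modality.index : Modality M → ModIndex M
  | .box s => s
  | .dia s => s

/-- The explicit moves of agent `i` that occur in `Ξ`. -/
def usedMoves (Ξ : Set (Modality M × PV)) (i : N) : Set (M i) :=
  ⋃ φ ∈ Ξ, ⋃ n ∈ φ.1.index.O, {u | ∃ h : i ∈ φ.1.index.ag, n ⟨i, h⟩ = u}

theorem usedMoves_finite {Ξ : Set (Modality M × PV)} (hΞ : Ξ.Finite) (i : N) :
    (usedMoves Ξ i).Finite := by
  refine hΞ.biUnion fun φ _ => φ.1.index.finite_O.biUnion fun n _ => ?_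
  refine Set.Subsingleton.finite ?_
  rintro _ ⟨_, rfl⟩ _ ⟨_, rfl⟩
  rfl

/-- The moves of agent `i` in the game built from `Ξ`: an explicit move occurring in `Ξ`, or a vote
for an atom (or for none) together with a contribution to the choice of a diamond. -/
abbrev Move (Ξ : Set (Modality M × PV)) (i : N) :=
  usedMoves Ξ i ⊕ (Option Ξ × (Ξ → ZMod 2))

namespace Move

variable {Ξ : Set (Modality M × PV)} {i : N}

/-- The explicit move that is played, if any. -/
def played : Move Ξ i → Option (M i) :=
  Sum.elim (fun u => some u.1) (fun _ => none)

/-- The atom that is voted for, if any. -/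
def vote : Move Ξ i → Option Ξ :=
  Sum.elim (fun _ => none) Prod.fst

/-- The contribution to the choice of a diamond. -/
def number : Move Ξ i → (Ξ → ZMod 2) :=
  Sum.elim (fun _ => 0) Prod.snd

open Classical in
/-- The interpretation of explicit moves. -/
noncomputable def name (u : M i) : Move Ξ i :=
  -- Names not occurring in `Ξ` need only a value without vote and with number zero.
  if h : u ∈ usedMoves Ξ i then .inl ⟨u, h⟩ else .inr (none, 0)

theorem played_name {φ : Modality M × PV} (hφ : φ ∈ Ξ) {n : JointMove M φ.1.index.ag}
    (hn : n ∈ φ.1.index.O) (j : φ.1.index.ag) :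
    (name (n j) : Move Ξ j).played = some (n j) := by
  have h : n j ∈ usedMoves Ξ (j : N) := by
    simp only [usedMoves, Set.mem_iUnion]
    exact ⟨φ, hφ, n, hn, j.2, rfl⟩
  simp [name, h, played]

theorem vote_name (u : M i) : (name u : Move Ξ i).vote = none := by
  unfold name
  split_ifs <;> rfl

theorem number_name (u : M i) : (name u : Move Ξ i).number = 0 := by
  unfold name
  split_ifs <;> rfl

/-- The source of side condition (3): coalitions of active boxes vote, agents in `L` name. -/
theorem played_eq_none_of_vote {x : Move Ξ i} {φ : Ξ} (h : x.vote = some φ) :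
    x.played = none := by
  rcases x with x | x
  · simp [vote] at h
  · rfl

end Move

/-! ### Active atoms and the two rules. -/

section Active

variable {Ξ : Set (Modality M × PV)}

/-- `m` plays, on the agents named by `s`, some element of the explicit strategy of `s`. -/
def PlaysSome (s : ModIndex M) (m : (i : N) → Move Ξ i) : Prop :=
  ∃ p ∈ s.O, ∀ i : s.ag, (m i).played = some (p i)

/-- The boxes of `Ξ` for which the whole coalition votes and whose explicit strategy is played. -/
def activeBoxes (m : (i : N) → Move Ξ i) : Set (ModIndex M × PV) :=
  {x | ∃ h : (Modality.box x.1, x.2) ∈ Ξ,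
    (∀ i ∈ x.1.C, (m i).vote = some ⟨_, h⟩) ∧ PlaysSome x.1 m}

/-- The grand coalition diamonds of `Ξ` whose explicit strategy is played. -/
def activeDias (m : (i : N) → Move Ξ i) : Set (ModIndex M × PV) :=
  {x | (Modality.dia x.1, x.2) ∈ Ξ ∧ x.1.C ∪ x.1.ag = Set.univ ∧ PlaysSome x.1 m}

/-- The variables of the active boxes and diamonds. -/
def activeVars (m : (i : N) → Move Ξ i) : Set PV :=
  Prod.snd '' activeBoxes m ∪ Prod.snd '' activeDias m

theorem exists_played_of_active {m : (i : N) → Move Ξ i} {i : N}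
    (hi : i ∈ namedAgents (activeBoxes m) (activeDias m)) : ∃ u, (m i).played = some u := by
  simp only [namedAgents, Set.mem_union, Set.mem_iUnion, exists_prop] at hi
  rcases hi with ⟨x, ⟨_, _, p, _, hp⟩, hi⟩ | ⟨x, ⟨_, _, p, _, hp⟩, hi⟩
  · exact ⟨_, hp ⟨i, hi⟩⟩
  · exact ⟨_, hp ⟨i, hi⟩⟩

/-- Grand coalition modalities are non-disjunctive, so the element played is the only one. -/
theorem played_of_mem_activeDias {m : (i : N) → Move Ξ i} {x : ModIndex M × PV}
    (hx : x ∈ activeDias m) {r : JointMove M x.1.ag} (hr : r ∈ x.1.O) (i : x.1.ag) :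
    (m i).played = some (r i) := by
  obtain ⟨_, hg, p, hp, hpm⟩ := hx
  obtain ⟨n, hn⟩ := x.1.grand hg
  rw [hn, Set.mem_singleton_iff] at hr hp
  subst hr hp
  exact hpm i

theorem snd_image_atomsOf (A B : Set (ModIndex M × PV)) :
    Prod.snd '' atomsOf A B = Prod.snd '' A ∪ Prod.snd '' B := by
  simp only [atomsOf, Set.image_union, Set.image_image]

/-- The active atoms are the premiss of an instance of (Rs): an agent has only one vote, so box
coalitions are disjoint, and `l` records the names actually played. -/
theorem activeVars_ext_nonempty {X : Type*} {τ : PV → Set X} (hΞ : Ξ.Finite)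
    (H : ∀ ρ ∈ ruleRs M PV, ρ.premiss ⊆ Ξ → ∃ Θ ∈ ρ.conclusions, (varsExt τ Θ).Nonempty)
    (m : (i : N) → Move Ξ i) : (varsExt τ (activeVars m)).Nonempty := by
  have hsub : atomsOf (activeBoxes m) (activeDias m) ⊆ Ξ := by
    rintro _ (⟨x, hx, rfl⟩ | ⟨x, hx, rfl⟩)
    · exact hx.1
    · exact hx.1
  choose l hl using fun i : namedAgents (activeBoxes m) (activeDias m) =>
    exists_played_of_active i.2
  have hbasic : BasicConditions (activeBoxes m) (activeDias m) := by
    refine ⟨?_, fun x hx => hx.2.1, ?_⟩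
    · rintro x ⟨hx, hxv, -⟩ y ⟨hy, hyv, -⟩ hne
      refine Set.disjoint_left.2 fun i hix hiy => hne ?_
      have := (hxv i hix).symm.trans (hyv i hiy)
      simp only [Option.some.injEq, Subtype.mk.injEq, Prod.mk.injEq, Modality.box.injEq] at this
      exact Prod.ext this.1 this.2
    · refine Set.disjoint_left.2 fun i hi hL => ?_
      simp only [Set.mem_iUnion, exists_prop] at hi
      obtain ⟨x, ⟨_, hxv, -⟩, hi⟩ := hi
      have := Move.played_eq_none_of_vote (hxv i hi)
      rw [hl ⟨i, hL⟩] at this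
      cases this
  let ρ : RuleInstance (Modality M) PV :=
    { premiss := atomsOf (activeBoxes m) (activeDias m)
      conclusions := {activeVars m}
      premiss_finite := hΞ.subset hsub
      conclusions_finite := Set.finite_singleton _
      conclusions_subset := by
        rintro _ rfl
        rw [snd_image_atomsOf]
        exact subset_rfl }
  have hρ : ρ ∈ ruleRs M PV := by
    refine ⟨activeBoxes m, activeDias m, hbasic, ⟨l, ?_, ?_⟩, rfl, rfl⟩
    · intro x hx r hr i hD hE
      exact Option.some.inj ((played_of_mem_activeDias hx hr ⟨i, hD⟩).symm.trans (hl ⟨i, hE⟩))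
    · rintro x ⟨_, _, p, hp, hpm⟩
      exact ⟨p, hp, fun i hD hE => Option.some.inj ((hpm ⟨i, hD⟩).symm.trans (hl ⟨i, hE⟩))⟩
  obtain ⟨_, rfl, hne⟩ := H ρ hρ hsub
  exact hne

open Classical in
/-- The joint move that plays `q` on the agents named by `s` and agrees with `m` elsewhere. -/
noncomputable def override (s : ModIndex M) (m : (i : N) → Move Ξ i) (q : JointMove M s.ag) :
    (i : N) → Move Ξ i :=
  fun i => if h : i ∈ s.ag then Move.name (q ⟨i, h⟩) else m i

theorem override_of_mem {s : ModIndex M} {i : N} (h : i ∈ s.ag) (m : (i : N) → Move Ξ i)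
    (q : JointMove M s.ag) : override s m q i = Move.name (q ⟨i, h⟩) := dif_pos h

theorem override_of_notMem {s : ModIndex M} {i : N} (h : i ∉ s.ag) (m : (i : N) → Move Ξ i)
    (q : JointMove M s.ag) : override s m q i = m i := dif_neg h

theorem override_of_mem_C {s : ModIndex M} {i : N} (h : i ∈ s.C) (m : (i : N) → Move Ξ i)
    (q : JointMove M s.ag) : override s m q i = m i :=
  override_of_notMem (Set.disjoint_left.1 s.disjoint h) m q

/-- One instance of (Rc) treats all `q` at once, with the atoms active under `q` as `A_q` and `B_q`.
By `hm`, only `s.C` can vote and only `s.C ∪ s.ag` can name, which gives (4) and (5). -/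
theorem activeVars_insert_ext_nonempty {X : Type*} {τ : PV → Set X} (hΞ : Ξ.Finite)
    (H : ∀ ρ ∈ ruleRc M PV, ρ.premiss ⊆ Ξ → ∃ Θ ∈ ρ.conclusions, (varsExt τ Θ).Nonempty)
    {s : ModIndex M} {b : PV} (hs : (Modality.dia s, b) ∈ Ξ) (hng : s.C ∪ s.ag ≠ Set.univ)
    (m : (i : N) → Move Ξ i)
    (hm : ∀ i ∉ s.C ∪ s.ag, (m i).vote = none ∧ (m i).played = none) :
    ∃ q ∈ s.O, (varsExt τ (insert b (activeVars (override s m q)))).Nonempty := by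
  set A : Set (ModIndex M × PV) := ⋃ q ∈ s.O, activeBoxes (override s m q) with hA
  set B : Set (ModIndex M × PV) := ⋃ q ∈ s.O, activeDias (override s m q) with hB
  have hAmem : ∀ x, x ∈ A ↔ ∃ q ∈ s.O, x ∈ activeBoxes (override s m q) := by
    simp [hA]
  have hBmem : ∀ x, x ∈ B ↔ ∃ q ∈ s.O, x ∈ activeDias (override s m q) := by
    simp [hB]
  have hsub : atomsOf A (insert (s, b) B) ⊆ Ξ := by
    rintro _ (⟨x, hx, rfl⟩ | ⟨x, rfl | hx, rfl⟩)
    · obtain ⟨q, _, hx⟩ := (hAmem x).1 hx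
      exact hx.1
    · exact hs
    · obtain ⟨q, _, hx⟩ := (hBmem x).1 hx
      exact hx.1
  have hvote : ∀ x ∈ A, ∀ i ∈ x.1.C, i ∈ s.C ∧
      ∃ h : (Modality.box x.1, x.2) ∈ Ξ, (m i).vote = some ⟨_, h⟩ := by
    intro x hx i hi
    obtain ⟨q, _, h, hv, -⟩ := (hAmem x).1 hx
    have hv := hv i hi
    by_cases hag : i ∈ s.ag
    · rw [override_of_mem hag, Move.vote_name] at hv
      cases hv
    · rw [override_of_notMem hag] at hv
      by_cases hC : i ∈ s.C
      · exact ⟨hC, h, hv⟩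
      · rw [(hm i (by simp [hC, hag])).1] at hv
        cases hv
  have hnamed : ∀ i ∈ namedAgents A B, ∃ q ∈ s.O, ∃ u, (override s m q i).played = some u := by
    intro i hi
    have : ∃ q ∈ s.O, i ∈ namedAgents (activeBoxes (override s m q))
        (activeDias (override s m q)) := by
      simp only [namedAgents, Set.mem_union, Set.mem_iUnion, exists_prop] at hi ⊢
      rcases hi with ⟨x, hx, hi⟩ | ⟨x, hx, hi⟩
      · obtain ⟨q, hq, hx⟩ := (hAmem x).1 hx
        exact ⟨q, hq, .inl ⟨x, hx, hi⟩⟩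
      · obtain ⟨q, hq, hx⟩ := (hBmem x).1 hx
        exact ⟨q, hq, .inr ⟨x, hx, hi⟩⟩
    obtain ⟨q, hq, hi⟩ := this
    exact ⟨q, hq, exists_played_of_active hi⟩
  have hnamedC : ∀ i : ↥(s.C ∩ namedAgents A B), ∃ u, (m i).played = some u := by
    rintro ⟨i, hC, hL⟩
    obtain ⟨q, _, u, hu⟩ := hnamed i hL
    rw [override_of_mem_C hC] at hu
    exact ⟨u, hu⟩
  -- Overriding leaves `s.C` unchanged, so the names played there give one `l` for all `q`, as (7)
  -- demands.
  choose l hl using hnamedC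
  have hq_played : ∀ q ∈ s.O, ∀ i (h : i ∈ s.ag),
      (override s m q i).played = some (q ⟨i, h⟩) := by
    intro q hq i h
    rw [override_of_mem h]
    exact Move.played_name hs hq ⟨i, h⟩
  have compat_q : ∀ q ∈ s.O, ∀ (D : Set N) (p : JointMove M D),
      (∀ i : D, (override s m q i).played = some (p i)) → Compatible p q :=
    fun q hq D p hp i hD hE => Option.some.inj ((hp ⟨i, hD⟩).symm.trans (hq_played q hq i hE))
  have compat_l : ∀ q ∈ s.O, ∀ (D : Set N) (p : JointMove M D),
      (∀ i : D, (override s m q i).played = some (p i)) → Compatible p l := by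
    intro q hq D p hp i hD hE
    have := hp ⟨i, hD⟩
    rw [override_of_mem_C hE.1] at this
    exact Option.some.inj (this.symm.trans (hl ⟨i, hE⟩))
  have hbasic : BasicConditions A B := by
    refine ⟨?_, ?_, ?_⟩
    · intro x hx y hy hne
      refine Set.disjoint_left.2 fun i hix hiy => hne ?_
      obtain ⟨_, _, h₁⟩ := hvote x hx i hix
      obtain ⟨_, _, h₂⟩ := hvote y hy i hiy
      have := h₁.symm.trans h₂
      simp only [Option.some.injEq, Subtype.mk.injEq, Prod.mk.injEq, Modality.box.injEq] at this
      exact Prod.ext this.1 this.2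
    · intro x hx
      obtain ⟨q, _, hx⟩ := (hBmem x).1 hx
      exact hx.2.1
    · refine Set.disjoint_left.2 fun i hi hL => ?_
      simp only [Set.mem_iUnion, exists_prop] at hi
      obtain ⟨x, hx, hi⟩ := hi
      obtain ⟨hC, _, hv⟩ := hvote x hx i hi
      have := Move.played_eq_none_of_vote hv
      rw [hl ⟨i, hC, hL⟩] at this
      cases this
  let ρ : RuleInstance (Modality M) PV :=
    { premiss := atomsOf A (insert (s, b) B)
      conclusions := {Θ | ∃ q ∈ s.O, Θ = Prod.snd '' activeBoxes (override s m q) ∪ {b} ∪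
        Prod.snd '' activeDias (override s m q)}
      premiss_finite := hΞ.subset hsub
      conclusions_finite := by
        refine (s.finite_O.image fun q => Prod.snd '' activeBoxes (override s m q) ∪ {b} ∪
          Prod.snd '' activeDias (override s m q)).subset ?_
        rintro _ ⟨q, hq, rfl⟩
        exact ⟨q, hq, rfl⟩
      conclusions_subset := by
        rintro _ ⟨q, hq, rfl⟩
        rw [snd_image_atomsOf, Set.image_insert_eq]
        rintro _ ((⟨x, hx, rfl⟩ | rfl) | ⟨x, hx, rfl⟩)
        · exact .inl ⟨x, (hAmem x).2 ⟨q, hq, hx⟩, rfl⟩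
        · exact .inr (.inl rfl)
        · exact .inr (.inr ⟨x, (hBmem x).2 ⟨q, hq, hx⟩, rfl⟩) }
  have hρ : ρ ∈ ruleRc M PV := by
    refine ⟨A, B, s, b, fun q => activeBoxes (override s m q),
      fun q => activeDias (override s m q), ?_, ?_, hbasic, ?_, ?_, ?_, ⟨l, ?_⟩, rfl, rfl⟩
    -- `B` contains only grand coalition diamonds, and `s` is not one.
    · intro h
      obtain ⟨q, _, h⟩ := (hBmem _).1 h
      exact hng h.2.1
    · exact fun q hq => ⟨fun x hx => (hAmem x).2 ⟨q, hq, hx⟩, fun x hx => (hBmem x).2 ⟨q, hq, hx⟩⟩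
    · exact Set.iUnion₂_subset fun x hx i hi => (hvote x hx i hi).1
    · intro i hi
      by_contra hi'
      obtain ⟨q, _, u, hu⟩ := hnamed i hi
      rw [override_of_notMem (fun h => hi' (.inr h)), (hm i hi').2] at hu
      cases hu
    · exact fun q hq x hx r hr => compat_q q hq _ r (played_of_mem_activeDias hx hr)
    · refine fun q hq => ⟨fun x hx r hr => compat_l q hq _ r (played_of_mem_activeDias hx hr), ?_⟩
      rintro x ⟨_, _, p, hp, hpm⟩
      exact ⟨p, hp, compat_q q hq _ p hpm, compat_l q hq _ p hpm⟩
  obtain ⟨_, ⟨q, hq, rfl⟩, hne⟩ := H ρ hρ hsub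
  refine ⟨q, hq, ?_⟩
  convert hne using 2
  simp only [activeVars]
  ext a
  simp only [Set.mem_insert_iff, Set.mem_union, Set.mem_singleton_iff]
  tauto

end Active

/-! ### Selecting a diamond by a sum. -/

section Construction

variable [Fintype N] {Ξ : Set (Modality M × PV)}

open Classical in
/-- The variables `b` of the diamonds selected by the sum of the agents' numbers. -/
def selectedVars (m : (i : N) → Move Ξ i) : Set PV :=
  {b | ∃ (s : ModIndex M) (h : (Modality.dia s, b) ∈ Ξ),
    ∑ i, (m i).number = Pi.single ⟨_, h⟩ 1}

open Classical in
theorem selectedVars_eq {m : (i : N) → Move Ξ i} {s : ModIndex M} {b : PV}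
    (h : (Modality.dia s, b) ∈ Ξ) (hm : ∑ i, (m i).number = Pi.single ⟨_, h⟩ 1) :
    selectedVars m = {b} := by
  refine Set.eq_singleton_iff_unique_mem.2 ⟨⟨s, h, hm⟩, ?_⟩
  rintro c ⟨t, ht, htm⟩
  have := congrFun (htm.symm.trans hm) ⟨_, ht⟩
  rw [Pi.single_eq_same] at this
  by_contra hne
  rw [Pi.single_eq_of_ne (by simp [hne])] at this
  exact one_ne_zero this

open Classical in
/-- For every non-grand diamond `s`, the agents outside `s` can select it by their numbers. -/
theorem exists_number_eq {s : ModIndex M} (hng : s.C ∪ s.ag ≠ Set.univ)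
    (mC : (i : s.C) → Move Ξ (i : N)) (z : Ξ → ZMod 2) :
    ∃ m : (i : N) → Move Ξ i, (∀ i : s.C, m i = mC i) ∧
      (∀ i ∉ s.C ∪ s.ag, (m i).vote = none ∧ (m i).played = none) ∧
      ∀ q, ∑ i, (override s m q i).number = z := by
  obtain ⟨j, hj⟩ := (Set.ne_univ_iff_exists_notMem _).1 hng
  have hjC : j ∉ s.C := fun h => hj (.inl h)
  have hjag : j ∉ s.ag := fun h => hj (.inr h)
  set m₀ : (i : N) → Move Ξ i :=
    fun i => if h : i ∈ s.C then mC ⟨i, h⟩ else .inr (none, 0) with hm₀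
  -- Apart from `j`, only `s.C` contributes: `s.ag` plays names, and the others play the default,
  -- all with number zero. Agent `j`, outside `s`, then supplies the difference.
  set w : Ξ → ZMod 2 := ∑ i ∈ Finset.univ.erase j, if i ∈ s.C then (m₀ i).number else 0
  refine ⟨Function.update m₀ j (.inr (none, z - w)), ?_, ?_, ?_⟩
  · rintro ⟨i, hi⟩
    have hij : i ≠ j := fun h => hjC (h ▸ hi)
    simp [Function.update_of_ne hij, hm₀, hi]
  · intro i hi
    by_cases hij : i = j
    · subst hij
      simp [Move.vote, Move.played]
    · have hiC : i ∉ s.C := fun h => hi (.inl h)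
      simp [Function.update_of_ne hij, hm₀, hiC, Move.vote, Move.played]
  · intro q
    rw [← Finset.add_sum_erase _ _ (Finset.mem_univ j), override_of_notMem hjag,
      Function.update_self]
    have : ∑ i ∈ Finset.univ.erase j,
        (override s (Function.update m₀ j (.inr (none, z - w))) q i).number = w := by
      refine Finset.sum_congr rfl fun i hi => ?_
      have hij := Finset.ne_of_mem_erase hi
      split_ifs with hC
      · rw [override_of_mem_C hC, Function.update_of_ne hij]
      · by_cases hag : i ∈ s.ag
        · rw [override_of_mem hag, Move.number_name]
        · rw [override_of_notMem hag, Function.update_of_ne hij]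
          simp [hm₀, hC, Move.number]
    rw [this]
    exact sub_add_cancel z w

end Construction

/-! ### Numbering the moves, and the final game. -/

/-- A satisfying game may have arbitrary finite nonempty types of moves. -/
theorem atomsExt_nonempty_of_finite_moves {X : Type*} {τ : PV → Set X}
    {Ξ : Set (Modality M × PV)} (V : N → Type*) [∀ i, Finite (V i)] [∀ i, Nonempty (V i)]
    (f : ((i : N) → V i) → X) (ι : (i : N) → M i → V i)
    (hbox : ∀ s a, (Modality.box s, a) ∈ Ξ → ∃ mC : (i : s.C) → V i, ∀ m : (i : N) → V i,
      (∀ i : s.C, m i = mC i) → (∃ n ∈ s.O, ∀ i : s.ag, m i = ι i (n i)) → f m ∈ τ a)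
    (hdia : ∀ s a, (Modality.dia s, a) ∈ Ξ → ∀ mC : (i : s.C) → V i, ∃ m : (i : N) → V i,
      (∀ i : s.C, m i = mC i) ∧ (∃ n ∈ s.O, ∀ i : s.ag, m i = ι i (n i)) ∧ f m ∈ τ a) :
    (atomsExt (lifting : Modality M → (X : Type _) → Set X → Set (Game M X)) τ Ξ).Nonempty := by
  let e := fun i => Finite.equivFin (V i)
  refine ⟨{ k := fun i => Nat.card (V i)
            one_le_k := fun i => Nat.card_pos
            outcome := fun m => f fun i => (e i).symm (m i)
            interp := fun i u => e i (ι i u) }, ?_⟩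
  rintro ⟨s | s, a⟩ hφ
  · obtain ⟨mC, h⟩ := hbox s a hφ
    refine ⟨fun i => e i (mC i), ?_⟩
    rintro m hm ⟨n, hn, hmn⟩
    refine h _ (fun i => ?_) ⟨n, hn, fun i => ?_⟩
    · rw [hm i, Equiv.symm_apply_apply]
    · rw [hmn i, Equiv.symm_apply_apply]
  · intro mC
    obtain ⟨m, hm, ⟨n, hn, hmn⟩, hf⟩ := hdia s a hφ fun i => (e i).symm (mC i)
    refine ⟨fun i => e i (m i), fun i => ?_, ⟨n, hn, fun i => ?_⟩, ?_⟩
    · exact (congrArg (e i) (hm i)).trans ((e i).apply_symm_apply _)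
    · exact congrArg (e i) (hmn i)
    · simpa using hf

end AMCDES

open AMCDES in
theorem mainTheorem3 {N : Type*} [Finite N] (M : N → Type*) (PV : Type*) :
    AMCDES.OneStepTableauComplete
      (AMCDES.lifting : AMCDES.Modality M → (X : Type*) → Set X → Set (AMCDES.Game M X))
      (AMCDES.ruleRs M PV ∪ AMCDES.ruleRc M PV) := by
  classical
  intro X τ Ξ hΞ H
  have := Fintype.ofFinite N
  have : Finite Ξ := hΞ
  have (i : N) : Finite (usedMoves Ξ i) := usedMoves_finite hΞ i
  have hRs := activeVars_ext_nonempty hΞ fun ρ hρ => H ρ (.inl hρ)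
  -- Active variables always hold at the outcome; the selected one holds whenever compatible with
  -- them.
  have hf : ∀ m : (i : N) → Move Ξ i, ∃ x ∈ varsExt τ (activeVars m),
      (varsExt τ (selectedVars m ∪ activeVars m)).Nonempty → x ∈ varsExt τ (selectedVars m) := by
    intro m
    by_cases h : (varsExt τ (selectedVars m ∪ activeVars m)).Nonempty
    · obtain ⟨x, hx⟩ := h
      exact ⟨x, fun a ha => hx a (.inr ha), fun _ a ha => hx a (.inl ha)⟩
    · obtain ⟨x, hx⟩ := hRs m
      exact ⟨x, hx, fun h' => (h h').elim⟩
  choose f hf_active hf_selected using hf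
  have hplays : ∀ φ ∈ Ξ, ∀ m : (i : N) → Move Ξ i,
      (∃ n ∈ φ.1.index.O, ∀ i : φ.1.index.ag, m i = Move.name (n i)) → PlaysSome φ.1.index m := by
    rintro φ hφ m ⟨n, hn, hmn⟩
    refine ⟨n, hn, fun i => ?_⟩
    rw [hmn i]
    exact Move.played_name hφ hn i
  refine atomsExt_nonempty_of_finite_moves (Move Ξ) f (fun i u => Move.name u) ?_ ?_
  · intro s a hφ
    refine ⟨fun i => .inr (some ⟨_, hφ⟩, 0), fun m hm hmn => ?_⟩
    refine hf_active m a (.inl ⟨(s, a), ⟨hφ, fun i hi => ?_, hplays _ hφ m hmn⟩, rfl⟩)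
    rw [hm ⟨i, hi⟩]
    rfl
  · intro s a hφ mC
    -- A grand coalition diamond becomes active as soon as its explicit strategy is played; any
    -- other has to be selected.
    by_cases hg : s.C ∪ s.ag = Set.univ
    · obtain ⟨n, hn⟩ := s.grand hg
      let m₀ : (i : N) → Move Ξ i := fun i => if h : i ∈ s.C then mC ⟨i, h⟩ else .inr (none, 0)
      have hmn : ∃ q ∈ s.O, ∀ i : s.ag, override s m₀ n i = Move.name (q i) :=
        ⟨n, hn ▸ rfl, fun i => override_of_mem i.2 _ _⟩
      refine ⟨override s m₀ n, fun i => ?_, hmn, ?_⟩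
      · rw [override_of_mem_C i.2]
        simp [m₀]
      · exact hf_active _ a (.inr ⟨(s, a), ⟨hφ, hg, hplays _ hφ _ hmn⟩, rfl⟩)
    · obtain ⟨m, hmC, hmo, hsum⟩ := exists_number_eq hg mC (Pi.single ⟨_, hφ⟩ 1)
      obtain ⟨q, hq, hne⟩ :=
        activeVars_insert_ext_nonempty hΞ (fun ρ hρ => H ρ (.inr hρ)) hφ hg m hmo
      have hsel := selectedVars_eq hφ (hsum q)
      refine ⟨override s m q, fun i => ?_, ⟨q, hq, fun i => override_of_mem i.2 _ _⟩, ?_⟩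
      · rw [override_of_mem_C i.2, hmC i]
      · refine hf_selected _ ?_ a (hsel ▸ rfl)
        rw [hsel, Set.singleton_union]
        exact hne
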